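/- Let $K$ be a field with $\operatorname{char} K\neq 2$, let $n\ge 0$ and $c\ge 1$ be integers, $S=K[x_1,\dots,x_n]$ and $\mathfrak m=(x_1,\dots,x_n)$. Let $F$ be the free $S$-module with basis elements $[u]$ indexed by the monomials $u\in S$ of degree $c$, and let $\phi:F\to S$ be the $S$-linear map with $\phi([u])=u$, so that $\phi(F)=\mathfrak m^c$. The Koszul complex $K(\mathfrak m^c,S)$ is the exterior algebra $\bigwedge^\bullet F$ with the differential $\partial$ determined by $\partial(1)=0$ and $\partial([u]\wedge f)=u f-[u]\wedge\partial(f)$; write $[u_1,\dots,u_t]=[u_1]\wedge\cdots\wedge[u_t]$, and give $v\,[u_1,\dots,u_t]$ the degree $\deg v+tc$ for every monomial $v$ of $S$. Let $Z_t=Z_t(\mathfrak m^c,S)=\{f\in\bigwedge^tF:\partial f=0\}$, and let $Z_1^2\subseteq Z_2$ be the $S$-submodule generated by the products of two elements of $Z_1$. Then the $S$-module $Z_2(\mathfrak m^c,S)$ is generated by the following two types of elements (which in particular all lie in $Z_2$). 1. The elements $$\sum_{\sigma\in\mathcal S_3}\operatorname{sgn}(\sigma)\,a_{\sigma(3)}\,[\,b_1a_{\sigma(1)},\,b_2a_{\sigma(2)}\,],$$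 where $a_1,a_2,a_3$ are monomials of degree $1$ and $b_1,b_2$ are monomials of degree $c-1$; they are homogeneous of degree $2c+1$. 2. The products $z_a(x_i,x_j)\,z_b(x_h,x_k)$, where $a,b$ are monomials of degree $c-1$, $i,j,h,k\in\{1,\dots,n\}$, and $z_b(x_j,x_k)=x_j[bx_k]-x_k[bx_j]\in Z_1$; they are homogeneous of degree $2c+2$, and they span, as a $K$-vector space, the homogeneous component of degree $2c+2$ of $Z_1^2$. -/

import Mathlib

/-- Monomials of degree `d` in the variables `x_1, …, x_n`, as exponent vectors. -/
abbrev Mon (n d : ℕ) : Type := {a : Fin n →₀ ℕ // a.degree = d}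

/-- The product of a monomial of degree `p` and a monomial of degree `q`, where `p + q = c`. -/
noncomputable def Mon.mul {n p q c : ℕ} (h : p + q = c) (a : Mon n p) (b : Mon n q) : Mon n c :=
  ⟨a.1 + b.1, by rw [map_add, a.2, b.2, h]⟩

/-- The variable `x_i` as a monomial of degree one. -/
noncomputable def Mon.var {n : ℕ} (i : Fin n) : Mon n 1 :=
  ⟨Finsupp.single i 1, Finsupp.degree_single i 1⟩

/-- A monomial as an element of the polynomial ring `S = K[x_1, …, x_n]`. -/
noncomputable def Mon.toPoly (K : Type*) [Field K] {n d : ℕ} (a : Mon n d) :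
    MvPolynomial (Fin n) K :=
  MvPolynomial.monomial a.1 1

/-- The free `S`-module `F` whose basis elements `[u]` are indexed by the monomials `u` of
degree `c`, that is, by the minimal generators of `𝔪 ^ c`. -/
abbrev VeroneseFree (K : Type*) [Field K] (n c : ℕ) : Type _ :=
  Mon n c →₀ MvPolynomial (Fin n) K

/-- The `S`-linear map `φ : F → S`, `[u] ↦ u`. -/
noncomputable def veronesePhi (K : Type*) [Field K] (n c : ℕ) :
    Module.Dual (MvPolynomial (Fin n) K) (VeroneseFree K n c) :=
  Finsupp.linearCombination (MvPolynomial (Fin n) K) (fun u : Mon n c => u.toPoly K)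

/-- The image of `φ` is the `c`-th power of the maximal homogeneous ideal
`𝔪 = (x_1, …, x_n)`. -/
theorem range_veronesePhi (K : Type*) [Field K] (n c : ℕ) :
    LinearMap.range (veronesePhi K n c) =
      (Ideal.span (Set.range (MvPolynomial.X : Fin n → MvPolynomial (Fin n) K))) ^ c := by
  rw [veronesePhi, Finsupp.range_linearCombination]
  refine Eq.trans ?_ (MvPolynomial.pow_idealOfVars_eq_span (σ := Fin n) (R := K) c).symm
  refine congrArg (Submodule.span _) ?_
  ext p
  simp [Mon.toPoly]

/-- The Koszul complex `K(𝔪 ^ c, S)` as a graded algebra: the exterior algebra of `F`, whose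
component of homological degree `t` is `⋀[S]^t F`. -/
abbrev Koszul (K : Type*) [Field K] (n c : ℕ) : Type _ :=
  ExteriorAlgebra (MvPolynomial (Fin n) K) (VeroneseFree K n c)

/-- The Koszul differential: the `S`-linear map with `∂ 1 = 0` and
`∂ ([u] ∧ f) = u f - [u] ∧ ∂ f`. -/
noncomputable def koszulDiff (K : Type*) [Field K] (n c : ℕ) :
    Koszul K n c →ₗ[MvPolynomial (Fin n) K] Koszul K n c :=
  CliffordAlgebra.contractLeft (veronesePhi K n c)

/-- The module `Z_t(𝔪 ^ c, S)` of Koszul cycles of homological degree `t`. -/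
noncomputable def koszulCycles (K : Type*) [Field K] (n c t : ℕ) :
    Submodule (MvPolynomial (Fin n) K) (Koszul K n c) :=
  (⋀[MvPolynomial (Fin n) K]^t (VeroneseFree K n c)) ⊓ LinearMap.ker (koszulDiff K n c)

/-- The element `[u_1, …, u_t] = [u_1] ∧ ⋯ ∧ [u_t]` for monomials `u_i` of degree `c`. -/
noncomputable def bracket (K : Type*) [Field K] {n c t : ℕ} (u : Fin t → Mon n c) :
    Koszul K n c :=
  ExteriorAlgebra.ιMulti (MvPolynomial (Fin n) K) t
    (fun i => (Finsupp.single (u i) 1 : VeroneseFree K n c))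

/-- The `K`-space of the elements of `⋀^t F` that are homogeneous of degree `d` in the internal
grading, in which `v [u_1, …, u_t]` has degree `deg v + t c` for every monomial `v`. -/
noncomputable def koszulHomogeneous (K : Type*) [Field K] (n c t d : ℕ) :
    Submodule K (Koszul K n c) :=
  Submodule.span K {z | ∃ (e : ℕ) (v : Mon n e) (u : Fin t → Mon n c),
    e + t * c = d ∧ z = v.toPoly K • bracket K u}

/-- The element `∑_σ sgn(σ) a_{σ(t+1)} [b_1 a_{σ(1)}, …, b_t a_{σ(t)}]`, where `σ` runs over the
permutations of `t + 1` letters, the `a_i` are monomials of degree `s`, and the `b_i` are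
monomials of degree `r = c - s`. -/
noncomputable def bcrElement (K : Type*) [Field K] {n c t r s : ℕ} (h : r + s = c)
    (a : Fin (t + 1) → Mon n s) (b : Fin t → Mon n r) : Koszul K n c :=
  ∑ σ : Equiv.Perm (Fin (t + 1)), (Equiv.Perm.sign σ : ℤ) •
    ((a (σ (Fin.last t))).toPoly K •
      bracket K (fun i : Fin t => Mon.mul h (b i) (a (σ i.castSucc))))

/-- The elements `bcrElement` of homological degree `t` and internal degree `d`: those built from
monomials `a_i` of degree `s ≤ c` with `t c + s = d`. -/
def bcrCycles (K : Type*) [Field K] (n c t d : ℕ) : Set (Koszul K n c) :=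
  {z | ∃ (s r : ℕ) (h : r + s = c) (a : Fin (t + 1) → Mon n s) (b : Fin t → Mon n r),
    t * c + s = d ∧ z = bcrElement K h a b}

/-- The element `z_b(x_i, x_j) = x_i [b x_j] - x_j [b x_i]` for a monomial `b` of degree
`r = c - 1`. -/
noncomputable def zElement (K : Type*) [Field K] {n c r : ℕ} (h : r + 1 = c) (b : Mon n r)
    (i j : Fin n) : Koszul K n c :=
  (MvPolynomial.X i : MvPolynomial (Fin n) K) •
      bracket K (fun _ : Fin 1 => Mon.mul h b (Mon.var j)) -
    (MvPolynomial.X j : MvPolynomial (Fin n) K) •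
      bracket K (fun _ : Fin 1 => Mon.mul h b (Mon.var i))

/-- The products `z_a(x_i, x_j) z_b(x_h, x_k)` in the exterior algebra, where `a`, `b` are
monomials of degree `c - 1`. -/
def zProducts (K : Type*) [Field K] (n c : ℕ) : Set (Koszul K n c) :=
  {w | ∃ (r : ℕ) (hr : r + 1 = c) (a b : Mon n r) (i j h k : Fin n),
    w = zElement K hr a i j * zElement K hr b h k}

/-! Let `N` be a submodule containing both types of elements. In each multidegree `d`, the class of
`x ^ (d - u - v) [u, v]` modulo `N` splits as `p u + q v` (`exists_pairVec_eq_add`). Granting this,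
take a 2-cycle `w` and write `2 w` as a sum over ordered pairs of basis elements. By the splitting,
its class is a sum of `K`-linear functions of the expressions `∑ u, coord u v w * u`, and these
vanish because `∂ w = 0`. Hence `2 w ∈ N`, and 2 is invertible.

The splitting is cohomological. The divisors of `d` of degree `c` form a graph whose edges `b x_i —
b x_j`, with `b x_i x_j` dividing `d`, exchange one variable. Modulo the products of the
`zElement`s, the change of the class along an edge in `u` does not depend on `v`
(`pairVec_exchange`), so it is a 1-cochain. It has a potential `p` as soon as it vanishes on the
triangles `b x_i, b x_j, b x_k` and `e x_i x_j, e x_j x_k, e x_k x_i` (`exists_potential`). If one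
`v` serves all three edges, the sum telescopes; the only other case is a triangle of the first kind
with `deg d = 2 c + 1`, where the sum is an element of the first type up to sign. Connectedness
(`eq_of_exchange`) then gives `q`.

The same connectedness shows that the `zElement`s generate `Z_1`. So `Z_1 ^ 2` is generated over `S`
by the `zProducts`, all of degree `2 c + 2`, and in that degree only the constant terms of the
coefficients survive. -/

/-! ### The exchange graph of the divisors of a monomial -/

/-- Two exponent vectors of the same degree are equal as soon as they are comparable. -/
theorem Finsupp.eq_of_le_of_degree_le {σ : Type*} {u v : σ →₀ ℕ} (h : u ≤ v)
    (hd : v.degree ≤ u.degree) : u = v := by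
  have h1 : (v - u) + u = v := tsub_add_cancel_of_le h
  have h2 : (v - u).degree = 0 := by
    have := congrArg Finsupp.degree h1
    rw [map_add] at this
    omega
  rw [Finsupp.degree_eq_zero_iff] at h2
  rw [← h1, h2, zero_add]

theorem Finsupp.exists_eq_add_single {σ : Type*} {u : σ →₀ ℕ} {c : ℕ} (h : u.degree = c + 1) :
    ∃ a i, u = a + Finsupp.single i 1 ∧ a.degree = c := by
  have hne : u ≠ 0 := by
    rintro rfl
    simp at h
  obtain ⟨i, hi⟩ := Finsupp.ne_iff.1 hne
  have hle : Finsupp.single i 1 ≤ u := by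
    rw [Finsupp.single_le_iff]
    exact Nat.one_le_iff_ne_zero.2 hi
  have h1 := tsub_add_cancel_of_le hle
  refine ⟨u - Finsupp.single i 1, i, h1.symm, ?_⟩
  have := congrArg Finsupp.degree h1
  rw [map_add, Finsupp.degree_single] at this
  omega

theorem Finsupp.add_single_le_of_le {σ : Type*} {u d : σ →₀ ℕ} {i : σ} (h : u ≤ d)
    (hu : u i = 0) (hd : d i ≠ 0) : u + Finsupp.single i 1 ≤ d := by
  intro k
  rcases eq_or_ne i k with rfl | hik
  · simp [hu, Nat.one_le_iff_ne_zero, hd]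
  · simpa [Finsupp.single_eq_of_ne' hik] using h k

/-- The divisors of degree `c` of a monomial are connected by the exchanges of one variable. -/
theorem eq_of_exchange {σ A : Type*} (c : ℕ) : ∀ (d : σ →₀ ℕ) (f : (σ →₀ ℕ) → A),
    (∀ a i j, a.degree + 1 = c → a + Finsupp.single i 1 + Finsupp.single j 1 ≤ d →
      f (a + Finsupp.single i 1) = f (a + Finsupp.single j 1)) →
    ∀ u v, u.degree = c → v.degree = c → u ≤ d → v ≤ d → f u = f v := by
  induction c with
  | zero =>
    intro d f _ u v hu hv _ _
    rw [Finsupp.degree_eq_zero_iff] at hu hv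
    rw [hu, hv]
  | succ c ih =>
    intro d f hf u v hu hv hud hvd
    obtain ⟨u', x, rfl, hu'⟩ := Finsupp.exists_eq_add_single hu
    have hxd : Finsupp.single x 1 ≤ d := le_trans le_add_self hud
    -- If `x` does not divide `v`, then `v x` still divides `d`, so some variable of `v` can be
    -- exchanged for `x`. Afterwards both divisors contain `x`, which is cancelled before the
    -- induction hypothesis is applied.
    have key : ∃ w, w.degree = c ∧ w + Finsupp.single x 1 ≤ d ∧
        f v = f (w + Finsupp.single x 1) := by
      by_cases hx : v x = 0
      · obtain ⟨w, j, rfl, hw⟩ := Finsupp.exists_eq_add_single hv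
        have h2 := Finsupp.add_single_le_of_le hvd hx
          (Nat.one_le_iff_ne_zero.1 (Finsupp.single_le_iff.1 hxd))
        refine ⟨w, hw, le_trans ?_ h2, hf w j x (by rw [hw]) h2⟩
        rw [add_right_comm]
        exact le_self_add
      · have hle : Finsupp.single x 1 ≤ v := by
          rw [Finsupp.single_le_iff]
          exact Nat.one_le_iff_ne_zero.2 hx
        have h1 := tsub_add_cancel_of_le hle
        refine ⟨v - Finsupp.single x 1, ?_, by rwa [h1], by rw [h1]⟩
        have := congrArg Finsupp.degree h1
        rw [map_add, Finsupp.degree_single] at this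
        omega
    obtain ⟨w, hw, hwd, hfw⟩ := key
    rw [hfw]
    refine ih (d - Finsupp.single x 1) (fun a => f (a + Finsupp.single x 1)) ?_ u' w hu' hw
      ((le_tsub_iff_right hxd).2 hud) ((le_tsub_iff_right hxd).2 hwd)
    intro a i j ha hij
    rw [le_tsub_iff_right hxd] at hij
    have := hf (a + Finsupp.single x 1) i j (by rw [map_add, Finsupp.degree_single, ha])
      (le_of_eq_of_le (by abel) hij)
    convert this using 2 <;> abel

/-- A one-cochain `s` on the exchange graph of the divisors of degree `c` of a monomial, which
vanishes on the two kinds of triangles, is a coboundary. -/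
theorem exists_potential {σ A : Type*} [AddCommGroup A] (c : ℕ) :
    ∀ (d : σ →₀ ℕ) (s : (σ →₀ ℕ) → σ → σ → A),
    (∀ b i, s b i i = 0) → (∀ b i j, s b i j = -s b j i) →
    (∀ b i j k, b.degree + 1 = c →
      b + Finsupp.single i 1 + Finsupp.single j 1 + Finsupp.single k 1 ≤ d →
      s b i j + s b j k + s b k i = 0) →
    (∀ e i j k, e.degree + 2 = c →
      e + Finsupp.single i 1 + Finsupp.single j 1 + Finsupp.single k 1 ≤ d →
      s (e + Finsupp.single i 1) j k + s (e + Finsupp.single j 1) k i +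
        s (e + Finsupp.single k 1) i j = 0) →
    ∃ p : (σ →₀ ℕ) → A, ∀ b i j, b.degree + 1 = c →
      b + Finsupp.single i 1 + Finsupp.single j 1 ≤ d →
      p (b + Finsupp.single i 1) - p (b + Finsupp.single j 1) = s b i j := by
  classical
  induction c with
  | zero => exact fun _ _ _ _ _ _ => ⟨0, fun b i j h => absurd h (Nat.succ_ne_zero _)⟩
  | succ c ih =>
    intro d s hs0 hs h1 h2
    by_cases hd : d = 0
    · refine ⟨0, fun b i j _ hle => ?_⟩
      have := hle i
      simp [hd] at this
    obtain ⟨x, hx⟩ := Finsupp.ne_iff.1 hd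
    have hxd : Finsupp.single x 1 ≤ d := by
      rw [Finsupp.single_le_iff]
      exact Nat.one_le_iff_ne_zero.2 hx
    obtain ⟨p', hp'⟩ := ih (d - Finsupp.single x 1) (fun b => s (b + Finsupp.single x 1))
      (fun b i => hs0 _ i) (fun b i j => hs _ i j)
      (fun b i j k hb hle => h1 _ i j k (by rw [map_add, Finsupp.degree_single, hb]) (le_of_eq_of_le (by abel) ((le_tsub_iff_right hxd).1 hle)))
      (fun e i j k he hle => by
        rw [le_tsub_iff_right hxd] at hle
        have := h2 (e + Finsupp.single x 1) i j k
          (by rw [map_add, Finsupp.degree_single]; omega) (le_of_eq_of_le (by abel) hle)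
        simpa only [add_right_comm e (Finsupp.single x 1)] using this)
    -- The potential on divisors containing `x` is `p'` after cancelling `x`. A divisor `b x_j`
    -- without `x` takes its value from its neighbour `b x`, and this must not depend on the choice
    -- of `j`.
    have hex : ∀ u : σ →₀ ℕ, ∃ q : A, u.degree = c + 1 → u ≤ d →
        (∀ b, u = b + Finsupp.single x 1 → q = p' b) ∧
        (u x = 0 → ∀ b j, u = b + Finsupp.single j 1 → q = p' b + s b j x) := by
      intro u
      by_cases hu : u.degree = c + 1
      swap
      · exact ⟨0, fun h => absurd h hu⟩
      by_cases hux : u x = 0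
      · obtain ⟨w, k, hwk, hw⟩ := Finsupp.exists_eq_add_single hu
        refine ⟨p' w + s w k x, fun _ hud => ⟨?_, ?_⟩⟩
        · rintro b rfl
          simp at hux
        · intro _ b j hbj
          rcases eq_or_ne k j with rfl | hkj
          · rw [add_right_cancel (hwk.symm.trans hbj)]
          have hb : Finsupp.single k 1 ≤ b := by
            rw [Finsupp.single_le_iff]
            have := DFunLike.congr_fun (hwk.symm.trans hbj) k
            simp only [Finsupp.add_apply, Finsupp.single_eq_same,
              Finsupp.single_eq_of_ne hkj] at this
            omega
          obtain ⟨e, rfl⟩ : ∃ e, b = e + Finsupp.single k 1 :=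
            ⟨_, (tsub_add_cancel_of_le hb).symm⟩
          obtain rfl : w = e + Finsupp.single j 1 := by
            have := hwk.symm.trans hbj
            rw [add_right_comm] at this
            exact add_right_cancel this
          rw [map_add, Finsupp.degree_single] at hw
          have hle := Finsupp.add_single_le_of_le hud hux hx
          have e1 := hp' e j k hw ((le_tsub_iff_right hxd).2 (by rwa [← hwk]))
          -- The triangle of the second kind with vertices `e x x_j`, `e x x_k`, `e x_j x_k`
          -- compares the two choices.
          have e2 := h2 e x j k (by omega) (le_of_eq_of_le (by rw [hwk]; abel) hle)
          rw [hs _ x j] at e2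
          rw [sub_eq_iff_eq_add] at e1
          rw [e1, ← sub_eq_zero, ← e2]
          abel
      · have hle : Finsupp.single x 1 ≤ u := by
          rw [Finsupp.single_le_iff]
          exact Nat.one_le_iff_ne_zero.2 hux
        refine ⟨p' (u - Finsupp.single x 1), fun _ _ => ⟨?_, fun h => absurd h hux⟩⟩
        rintro b rfl
        rw [add_tsub_cancel_right]
    choose p hp using hex
    refine ⟨p, fun b i j hb hle => ?_⟩
    have hbc : ∀ k, (b + Finsupp.single k 1).degree = c + 1 := fun k => by
      rw [map_add, Finsupp.degree_single, hb]
    have hi := hp _ (hbc i) (le_trans le_self_add hle)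
    have hj := hp _ (hbc j) (le_trans le_self_add (by rwa [add_right_comm] at hle))
    rcases eq_or_ne i j with rfl | hij
    · rw [sub_self, hs0]
    by_cases hbx : b x = 0
    · rcases eq_or_ne i x with rfl | hix
      · rw [hi.1 b rfl, hj.2 (by simp [hbx, Finsupp.single_eq_of_ne hij]) b j rfl, hs b j i]
        abel
      rcases eq_or_ne j x with rfl | hjx
      · rw [hj.1 b rfl, hi.2 (by simp [hbx, Finsupp.single_eq_of_ne' hix]) b i rfl]
        abel
      rw [hi.2 (by simp [hbx, Finsupp.single_eq_of_ne' hix]) b i rfl,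
        hj.2 (by simp [hbx, Finsupp.single_eq_of_ne' hjx]) b j rfl]
      -- Neither end of the edge contains `x`: both values come from the neighbour `b x`, and the
      -- triangle `b x_i, b x_j, b x` of the first kind closes up.
      have := h1 b i j x hb (Finsupp.add_single_le_of_le hle
        (by simp [hbx, Finsupp.single_eq_of_ne' hix, Finsupp.single_eq_of_ne' hjx]) hx)
      rw [hs b x i] at this
      rw [← sub_eq_zero, ← neg_eq_zero, ← this]
      abel
    · have hxb : Finsupp.single x 1 ≤ b := by
        rw [Finsupp.single_le_iff]
        exact Nat.one_le_iff_ne_zero.2 hbx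
      obtain ⟨e, rfl⟩ : ∃ e, b = e + Finsupp.single x 1 :=
        ⟨_, (tsub_add_cancel_of_le hxb).symm⟩
      rw [hi.1 (e + Finsupp.single i 1) (add_right_comm _ _ _),
        hj.1 (e + Finsupp.single j 1) (add_right_comm _ _ _)]
      refine hp' e i j ?_ ((le_tsub_iff_right hxd).2 (le_of_eq_of_le (by abel) hle))
      rw [map_add, Finsupp.degree_single] at hb
      omega

/-! ### Explicit formulas in homological degrees one and two -/

theorem MvPolynomial.monomial_add_single_one {σ R : Type*} [CommSemiring R] (m : σ →₀ ℕ) (i : σ) :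
    MvPolynomial.monomial (m + Finsupp.single i 1) (1 : R) =
      MvPolynomial.monomial m 1 * MvPolynomial.X i := by
  rw [MvPolynomial.X, MvPolynomial.monomial_mul, one_mul]

theorem MvPolynomial.exists_linearMap_monomial {σ K A : Type*} [Field K] [AddCommGroup A]
    [Module K A] (g : (σ →₀ ℕ) → A) :
    ∃ P : MvPolynomial σ K →ₗ[K] A, ∀ m, P (MvPolynomial.monomial m 1) = g m :=
  ⟨(MvPolynomial.basisMonomials σ K).constr K g, fun m => by
    rw [← (MvPolynomial.basisMonomials σ K).constr_basis K g m, MvPolynomial.coe_basisMonomials]⟩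

section

variable (K : Type*) [Field K] {n : ℕ} (c : ℕ)

/-- The basis element `[u]` of `F` inside the Koszul complex, with `[u] = 0` if the exponent vector
`u` does not have degree `c`. -/
noncomputable def basisVec (u : Fin n →₀ ℕ) : Koszul K n c :=
  open Classical in
  if h : u.degree = c then
    ExteriorAlgebra.ι (MvPolynomial (Fin n) K) (Finsupp.single (⟨u, h⟩ : Mon n c) 1) else 0

variable {c}

theorem basisVec_coe (u : Mon n c) :
    basisVec K c u.1 = ExteriorAlgebra.ι (MvPolynomial (Fin n) K) (Finsupp.single u 1) := by
  rw [basisVec, dif_pos u.2]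

theorem bracket_one (u : Fin 1 → Mon n c) : bracket K u = basisVec K c (u 0).1 := by
  rw [basisVec_coe, bracket, ExteriorAlgebra.ιMulti_apply]
  simp

theorem bracket_two (u : Fin 2 → Mon n c) :
    bracket K u = basisVec K c (u 0).1 * basisVec K c (u 1).1 := by
  rw [basisVec_coe, basisVec_coe, bracket, ExteriorAlgebra.ιMulti_apply]
  simp [List.ofFn_succ]

theorem basisVec_mul_comm (u v : Fin n →₀ ℕ) :
    basisVec K c u * basisVec K c v = -(basisVec K c v * basisVec K c u) := by
  unfold basisVec
  split_ifs
  · exact eq_neg_of_add_eq_zero_left (ExteriorAlgebra.ι_add_mul_swap _ _)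
  all_goals simp

theorem koszulDiff_basisVec_mul {u : Fin n →₀ ℕ} (hu : u.degree = c) (w : Koszul K n c) :
    koszulDiff K n c (basisVec K c u * w) =
      (MvPolynomial.monomial u (1 : K)) • w - basisVec K c u * koszulDiff K n c w := by
  rw [basisVec, dif_pos hu, koszulDiff]
  refine (CliffordAlgebra.contractLeft_ι_mul _ _ _).trans ?_
  simp [veronesePhi, Mon.toPoly]

theorem koszulDiff_basisVec {u : Fin n →₀ ℕ} (hu : u.degree = c) :
    koszulDiff K n c (basisVec K c u) = MvPolynomial.monomial u (1 : K) • 1 := by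
  have := koszulDiff_basisVec_mul K hu (1 : Koszul K n c)
  rwa [mul_one, koszulDiff, CliffordAlgebra.contractLeft_one, mul_zero, sub_zero] at this

theorem zElement_eq {r : ℕ} (h : r + 1 = c) (b : Mon n r) (i j : Fin n) :
    zElement K h b i j =
      (MvPolynomial.X i : MvPolynomial (Fin n) K) • basisVec K c (b.1 + Finsupp.single j 1) -
      (MvPolynomial.X j : MvPolynomial (Fin n) K) • basisVec K c (b.1 + Finsupp.single i 1) := by
  rw [zElement, bracket_one, bracket_one]
  rfl

theorem univ_perm_fin_three : (Finset.univ : Finset (Equiv.Perm (Fin 3))) =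
    {1, Equiv.swap 0 1, Equiv.swap 0 2, Equiv.swap 1 2, finRotate 3, (finRotate 3)⁻¹} := by
  decide

theorem bcrElement_two {r : ℕ} (h : r + 1 = c) (a : Fin 3 → Mon n 1) (b : Fin 2 → Mon n r)
    (i j k : Fin n) (hi : (a 0).1 = Finsupp.single i 1) (hj : (a 1).1 = Finsupp.single j 1)
    (hk : (a 2).1 = Finsupp.single k 1) :
    bcrElement K h a b =
      (MvPolynomial.X k : MvPolynomial (Fin n) K) •
        (basisVec K c ((b 0).1 + Finsupp.single i 1) * basisVec K c ((b 1).1 + Finsupp.single j 1))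
      - (MvPolynomial.X k : MvPolynomial (Fin n) K) •
        (basisVec K c ((b 0).1 + Finsupp.single j 1) * basisVec K c ((b 1).1 + Finsupp.single i 1))
      - (MvPolynomial.X i : MvPolynomial (Fin n) K) •
        (basisVec K c ((b 0).1 + Finsupp.single k 1) * basisVec K c ((b 1).1 + Finsupp.single j 1))
      - (MvPolynomial.X j : MvPolynomial (Fin n) K) •
        (basisVec K c ((b 0).1 + Finsupp.single i 1) * basisVec K c ((b 1).1 + Finsupp.single k 1))
      + (MvPolynomial.X i : MvPolynomial (Fin n) K) •
        (basisVec K c ((b 0).1 + Finsupp.single j 1) * basisVec K c ((b 1).1 + Finsupp.single k 1))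
      + (MvPolynomial.X j : MvPolynomial (Fin n) K) •
        (basisVec K c ((b 0).1 + Finsupp.single k 1) *
          basisVec K c ((b 1).1 + Finsupp.single i 1)) := by
  have hX : ∀ (m : Mon n 1) (l : Fin n), m.1 = Finsupp.single l 1 →
      m.toPoly K = MvPolynomial.X l := fun m l hm => by rw [Mon.toPoly, hm]; rfl
  have e1 : (finRotate 3) 0 = 1 := by decide
  have e2 : (finRotate 3) 1 = 2 := by decide
  have e3 : (finRotate 3) 2 = 0 := by decide
  have e4 : (finRotate 3)⁻¹ 0 = 2 := by decide
  have e5 : (finRotate 3)⁻¹ 1 = 0 := by decide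
  have e6 : (finRotate 3)⁻¹ 2 = 1 := by decide
  have s1 : Equiv.Perm.sign (Equiv.swap (0 : Fin 3) 1) = -1 := by decide
  have s2 : Equiv.Perm.sign (Equiv.swap (0 : Fin 3) 2) = -1 := by decide
  have s3 : Equiv.Perm.sign (Equiv.swap (1 : Fin 3) 2) = -1 := by decide
  have s4 : Equiv.Perm.sign (finRotate 3) = 1 := by decide
  have s5 : Equiv.Perm.sign (finRotate 3)⁻¹ = 1 := by decide
  have w1 : (Equiv.swap (0 : Fin 3) 1) 2 = 2 := by decide
  have w2 : (Equiv.swap (0 : Fin 3) 2) 1 = 1 := by decide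
  have w3 : (Equiv.swap (1 : Fin 3) 2) 0 = 0 := by decide
  have l2 : Fin.last 2 = 2 := rfl
  have c0 : Fin.castSucc (0 : Fin 2) = 0 := rfl
  have c1 : Fin.castSucc (1 : Fin 2) = 1 := rfl
  rw [bcrElement, univ_perm_fin_three, Finset.sum_insert (by decide), Finset.sum_insert (by decide),
    Finset.sum_insert (by decide), Finset.sum_insert (by decide), Finset.sum_insert (by decide),
    Finset.sum_singleton]
  simp only [bracket_two, Mon.mul, l2, c0, c1, e1, e2, e3, e4, e5, e6, s1, s2, s3, s4, s5, w1, w2,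
    w3, Equiv.swap_apply_left, Equiv.swap_apply_right, Equiv.Perm.one_apply, Equiv.Perm.sign_one,
    hi, hj, hk, hX _ _ hi, hX _ _ hj, hX _ _ hk, Units.val_neg, Units.val_one, neg_smul, one_smul]
  abel

variable (c) in
/-- The generator `x ^ (d - u - v) [u, v]` of the component of multidegree `d` of `⋀² F`. -/
noncomputable def pairVec (d u v : Fin n →₀ ℕ) : Koszul K n c :=
  MvPolynomial.monomial (d - (u + v)) (1 : K) • (basisVec K c u * basisVec K c v)

theorem pairVec_eq {d u v : Fin n →₀ ℕ} (m : Fin n →₀ ℕ) (h : d = m + (u + v)) :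
    pairVec K c d u v =
      MvPolynomial.monomial m (1 : K) • (basisVec K c u * basisVec K c v) := by
  rw [pairVec, h, add_tsub_cancel_right]

end

/-! ### Splitting the class of `[u, v]` modulo the two types of cycles -/

section

variable {K : Type*} [Field K] {n c : ℕ}
  {N : Submodule (MvPolynomial (Fin n) K) (Koszul K n c)}

/-- Modulo the products of the `zElement`s, an exchange in the first factor of `[u, v]` does not
depend on `v`. -/
theorem pairVec_exchange (hz : zProducts K n c ⊆ N) {d b : Fin n →₀ ℕ} {i j : Fin n}
    (hb : b.degree + 1 = c) {v v' : Fin n →₀ ℕ} (hv : v.degree = c) (hv' : v'.degree = c)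
    (hvd : b + Finsupp.single i 1 + Finsupp.single j 1 + v ≤ d)
    (hvd' : b + Finsupp.single i 1 + Finsupp.single j 1 + v' ≤ d) :
    N.mkQ (pairVec K c d (b + Finsupp.single i 1) v - pairVec K c d (b + Finsupp.single j 1) v) =
    N.mkQ (pairVec K c d (b + Finsupp.single i 1) v' -
      pairVec K c d (b + Finsupp.single j 1) v') := by
  have hg : b + Finsupp.single i 1 + Finsupp.single j 1 ≤ d := le_trans le_self_add hvd
  refine eq_of_exchange c (d - (b + Finsupp.single i 1 + Finsupp.single j 1))
    (fun v => N.mkQ (pairVec K c d (b + Finsupp.single i 1) v -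
      pairVec K c d (b + Finsupp.single j 1) v)) ?_ v v' hv hv'
    ((le_tsub_iff_left hg).2 hvd) ((le_tsub_iff_left hg).2 hvd')
  intro a h k ha hle
  rw [le_tsub_iff_left hg, le_iff_exists_add'] at hle
  obtain ⟨m, hm⟩ := hle
  rw [← sub_eq_zero, ← map_sub, Submodule.mkQ_apply, Submodule.Quotient.mk_eq_zero]
  -- Multiplied by `x ^ m`, this product is the difference between the exchange at `v = a x_h` and
  -- the one at `v = a x_k`.
  have hmem : zElement K hb ⟨b, rfl⟩ j i * zElement K hb ⟨a, by omega⟩ k h ∈ N :=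
    hz ⟨_, hb, _, _, j, i, k, h, rfl⟩
  have := N.smul_mem (MvPolynomial.monomial m 1) hmem
  rw [pairVec_eq K (m + Finsupp.single j 1 + Finsupp.single k 1) (by rw [hm]; abel),
    pairVec_eq K (m + Finsupp.single i 1 + Finsupp.single k 1) (by rw [hm]; abel),
    pairVec_eq K (m + Finsupp.single j 1 + Finsupp.single h 1) (by rw [hm]; abel),
    pairVec_eq K (m + Finsupp.single i 1 + Finsupp.single h 1) (by rw [hm]; abel)]
  simp only [MvPolynomial.monomial_add_single_one]
  rw [zElement_eq, zElement_eq] at this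
  simp only [sub_mul, mul_sub, smul_mul_smul_comm] at this
  convert this using 1
  module

/-- Modulo the two types of cycles, the class of `x ^ (d - u - v) [u, v]` is the sum of an element
depending only on `u` and one depending only on `v`. -/
theorem exists_pairVec_eq_add (hb : bcrCycles K n c 2 (2 * c + 1) ⊆ N)
    (hz : zProducts K n c ⊆ N) (d : Fin n →₀ ℕ) :
    ∃ p q : (Fin n →₀ ℕ) → Koszul K n c ⧸ N, ∀ u v, u.degree = c → v.degree = c → u + v ≤ d →
      N.mkQ (pairVec K c d u v) = p u + q v := by
  by_cases hd : d.degree ≤ 2 * c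
  -- In degree at most `2 c`, `u + v ≤ d` forces `v = d - u`, so the class depends on `u` alone.
  · refine ⟨fun u => N.mkQ (pairVec K c d u (d - u)), 0, fun u v hu hv huv => ?_⟩
    rw [← Finsupp.eq_of_le_of_degree_le huv (by rw [map_add]; omega)]
    simp
  push Not at hd
  -- Since `deg d ≥ 2 c + 1`, every edge, with `g = b x_i x_j` of degree `c + 1`, leaves room for
  -- some `v`. The choice depends on `g` only, which makes the triangles of the second kind
  -- telescope.
  have hV : ∀ g : Fin n →₀ ℕ, ∃ v : Fin n →₀ ℕ, g.degree = c + 1 → g ≤ d →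
      v.degree = c ∧ g + v ≤ d := by
    intro g
    by_cases hg : g.degree = c + 1 ∧ g ≤ d
    · have := congrArg Finsupp.degree (add_tsub_cancel_of_le hg.2)
      rw [map_add] at this
      obtain ⟨v, hv, hvc⟩ := Finsupp.exists_le_degree_eq (d - g) c (by omega)
      exact ⟨v, fun _ _ => ⟨hvc, (le_tsub_iff_left hg.2).1 hv⟩⟩
    · exact ⟨0, fun h1 h2 => absurd ⟨h1, h2⟩ hg⟩
  choose V hV using hV
  let s : (Fin n →₀ ℕ) → Fin n → Fin n → Koszul K n c ⧸ N := fun b i j =>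
    N.mkQ (pairVec K c d (b + Finsupp.single i 1)
        (V (b + Finsupp.single i 1 + Finsupp.single j 1)) -
      pairVec K c d (b + Finsupp.single j 1)
        (V (b + Finsupp.single i 1 + Finsupp.single j 1)))
  have hs : ∀ b i j v, b.degree + 1 = c → v.degree = c →
      b + Finsupp.single i 1 + Finsupp.single j 1 + v ≤ d →
      s b i j = N.mkQ (pairVec K c d (b + Finsupp.single i 1) v -
        pairVec K c d (b + Finsupp.single j 1) v) := by
    intro b i j v hbc hv hle
    have h := hV (b + Finsupp.single i 1 + Finsupp.single j 1)
      (by simp only [map_add, Finsupp.degree_single]; omega) (le_trans le_self_add hle)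
    exact pairVec_exchange hz hbc h.1 hv h.2 hle
  obtain ⟨p, hp⟩ := exists_potential c d s (fun b i => by simp [s])
    (fun b i j => by
      simp only [s]
      rw [← map_neg, neg_sub, add_right_comm b])
    (by
      intro b i j k hbc hle
      obtain ⟨m, hm⟩ := le_iff_exists_add.1 hle
      have hmd := congrArg Finsupp.degree hm
      simp only [map_add, Finsupp.degree_single] at hmd
      -- Here `deg d = c + 2 + deg m ≥ 2 c + 1`, so `deg m ≥ c - 1`. If `deg m ≥ c`, a divisor of
      -- `m` serves as a common `v`; otherwise `deg m = c - 1`.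
      by_cases hmc : c ≤ m.degree
      · obtain ⟨v, hvm, hv⟩ := Finsupp.exists_le_degree_eq m c hmc
        have hle' : b + Finsupp.single i 1 + Finsupp.single j 1 + Finsupp.single k 1 + v ≤ d := by
          rw [hm]
          gcongr
        rw [hs b i j v hbc hv (le_trans
            (le_of_le_of_eq (le_self_add (b := Finsupp.single k 1)) (by abel)) hle'),
          hs b j k v hbc hv (le_trans
            (le_of_le_of_eq (le_self_add (b := Finsupp.single i 1)) (by abel)) hle'),
          hs b k i v hbc hv (le_trans
            (le_of_le_of_eq (le_self_add (b := Finsupp.single j 1)) (by abel)) hle'),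
          ← map_add, ← map_add]
        simp
      · have hm1 : m.degree + 1 = c := by omega
        have hm2 : ∀ l, (m + Finsupp.single l 1).degree = c := fun l => by
          rw [map_add, Finsupp.degree_single, hm1]
        rw [hs b i j (m + Finsupp.single k 1) hbc (hm2 k) (le_of_eq (by rw [hm]; abel)),
          hs b j k (m + Finsupp.single i 1) hbc (hm2 i) (le_of_eq (by rw [hm]; abel)),
          hs b k i (m + Finsupp.single j 1) hbc (hm2 j) (le_of_eq (by rw [hm]; abel)),
          ← map_add, ← map_add, Submodule.mkQ_apply, Submodule.Quotient.mk_eq_zero]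
        -- No common `v` exists, so the three edges use `m x_k`, `m x_i`, `m x_j`. The resulting six
        -- terms are minus the element built from `x_i, x_j, x_k` and `b, m`.
        have hmem := N.neg_mem (hb ⟨1, b.degree, hbc, ![Mon.var i, Mon.var j, Mon.var k],
          ![⟨b, rfl⟩, ⟨m, by omega⟩], by ring, rfl⟩)
        rw [bcrElement_two K hbc _ _ i j k rfl rfl rfl] at hmem
        rw [pairVec_eq K (Finsupp.single j 1) (by rw [hm]; abel),
          pairVec_eq K (Finsupp.single i 1) (by rw [hm]; abel),
          pairVec_eq K (Finsupp.single k 1) (by rw [hm]; abel),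
          pairVec_eq K (Finsupp.single j 1) (by rw [hm]; abel),
          pairVec_eq K (Finsupp.single i 1) (by rw [hm]; abel),
          pairVec_eq K (Finsupp.single k 1) (by rw [hm]; abel)]
        convert hmem using 1
        simp only [MvPolynomial.X, Matrix.cons_val_zero, Matrix.cons_val_one]
        abel)
    (by
      intro e i j k _ _
      simp only [s]
      rw [add_right_comm e (Finsupp.single j 1) (Finsupp.single k 1),
        add_right_comm e (Finsupp.single j 1) (Finsupp.single i 1),
        add_right_comm e (Finsupp.single k 1) (Finsupp.single i 1),
        add_right_comm (e + Finsupp.single i 1) (Finsupp.single k 1) (Finsupp.single j 1),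
        ← map_add, ← map_add]
      have : e + Finsupp.single k 1 + Finsupp.single j 1 + Finsupp.single i 1 =
          e + Finsupp.single i 1 + Finsupp.single j 1 + Finsupp.single k 1 := by abel
      simp [this])
  -- Along an exchange in `u`, the class and `p` change by the same amount, so their difference is
  -- constant in `u`.
  have hq : ∀ v : Fin n →₀ ℕ, ∃ q : Koszul K n c ⧸ N, ∀ u : Fin n →₀ ℕ, u.degree = c →
      v.degree = c → u + v ≤ d → N.mkQ (pairVec K c d u v) - p u = q := by
    intro v
    by_cases h : ∃ u₀ : Fin n →₀ ℕ, u₀.degree = c ∧ v.degree = c ∧ u₀ + v ≤ d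
    · obtain ⟨u₀, hu₀, hv, hle₀⟩ := h
      refine ⟨N.mkQ (pairVec K c d u₀ v) - p u₀, fun u hu _ hle => ?_⟩
      have hvd : v ≤ d := le_trans le_add_self hle
      refine eq_of_exchange c (d - v) (fun u => N.mkQ (pairVec K c d u v) - p u) ?_ u u₀ hu hu₀
        ((le_tsub_iff_right hvd).2 hle) ((le_tsub_iff_right hvd).2 hle₀)
      intro a i j ha hij
      rw [le_tsub_iff_right hvd] at hij
      have h1 := hp a i j ha (le_trans le_self_add hij)
      rw [hs a i j v ha hv hij, map_sub, sub_eq_sub_iff_add_eq_add] at h1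
      exact sub_eq_sub_iff_add_eq_add.2 (h1.symm.trans (add_comm _ _))
    · exact ⟨0, fun u hu hv hle => absurd ⟨u, hu, hv, hle⟩ h⟩
  choose q hq using hq
  exact ⟨p, q, fun u v hu hv huv => by rw [← hq v u hu hv huv, add_sub_cancel]⟩

end

/-! ### Generators of the cycles in homological degrees one and two -/

noncomputable instance (n d : ℕ) : Fintype (Mon n d) :=
  haveI : Finite (Mon n d) := Finsupp.finite_of_degree_eq (σ := Fin n) d
  Fintype.ofFinite _

section

variable {K : Type*} [Field K] {n c : ℕ}
  {N : Submodule (MvPolynomial (Fin n) K) (Koszul K n c)}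

theorem VeroneseFree.sum_smul_single (m : VeroneseFree K n c) :
    ∑ u, m u • (Finsupp.single u 1 : VeroneseFree K n c) = m := by
  conv_rhs => rw [← Finsupp.sum_single m, Finsupp.sum_fintype _ _ (by simp)]
  simp

theorem basisVec_mem_range (u : Fin n →₀ ℕ) : basisVec K c u ∈
    LinearMap.range (ExteriorAlgebra.ι (MvPolynomial (Fin n) K) (M := VeroneseFree K n c)) := by
  unfold basisVec
  split_ifs
  · exact ⟨_, rfl⟩
  · exact zero_mem _

theorem ι_eq_sum (m : VeroneseFree K n c) :
    ExteriorAlgebra.ι (MvPolynomial (Fin n) K) m = ∑ u, m u • basisVec K c u.1 := by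
  conv_lhs => rw [← VeroneseFree.sum_smul_single m]
  simp only [map_sum, map_smul, basisVec_coe]

/-- The class of `f [u, v]` modulo the two types of cycles, as a function of `f v` and `f u`. -/
theorem exists_smul_basisVec_mul_eq_add (hb : bcrCycles K n c 2 (2 * c + 1) ⊆ N)
    (hz : zProducts K n c ⊆ N) :
    ∃ P Q : Mon n c → MvPolynomial (Fin n) K →ₗ[K] Koszul K n c ⧸ N, ∀ u v f,
      N.mkQ (f • (basisVec K c u.1 * basisVec K c v.1)) =
        P u (f * v.toPoly K) + Q v (f * u.toPoly K) := by
  choose p q hpq using exists_pairVec_eq_add hb hz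
  -- `P u` is evaluated at `f v`; a monomial `d` occurring there belongs to the multidegree `d + u`.
  choose P hP using fun u : Mon n c => MvPolynomial.exists_linearMap_monomial (K := K)
    fun d : Fin n →₀ ℕ => p (d + u.1) u.1
  choose Q hQ using fun v : Mon n c => MvPolynomial.exists_linearMap_monomial (K := K)
    fun d : Fin n →₀ ℕ => q (d + v.1) v.1
  refine ⟨P, Q, fun u v f => ?_⟩
  induction f using MvPolynomial.induction_on' with
  | monomial m a =>
    have hm : MvPolynomial.monomial m a = a • MvPolynomial.monomial m (1 : K) := by
      rw [MvPolynomial.smul_monomial, smul_eq_mul, mul_one]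
    have h := hpq (m + (u.1 + v.1)) u.1 v.1 u.2 v.2 le_add_self
    rw [pairVec_eq K m rfl] at h
    rw [hm, smul_mul_assoc, smul_mul_assoc, smul_assoc, (P u).map_smul, (Q v).map_smul, Mon.toPoly,
      Mon.toPoly, MvPolynomial.monomial_mul, MvPolynomial.monomial_mul, one_mul, hP, hQ,
      Submodule.mkQ_apply, Submodule.Quotient.mk_smul N a, ← Submodule.mkQ_apply, h, smul_add,
      add_right_comm m v.1, add_assoc m]
  | add f g hf hg =>
    rw [add_smul, map_add, hf, hg, add_mul, add_mul, map_add, map_add]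
    abel

/-- In each multidegree, modulo the `zElement`s, exchanges do not change the class of `x ^ (d - u)
[u]`, which therefore depends on `d` alone. -/
theorem exists_smul_basisVec_eq (hz : ∀ (r : ℕ) (h : r + 1 = c) (b : Mon n r) (i j : Fin n),
    zElement K h b i j ∈ N) :
    ∃ P : MvPolynomial (Fin n) K →ₗ[K] Koszul K n c ⧸ N, ∀ (u : Mon n c) f,
      N.mkQ (f • basisVec K c u.1) = P (f * u.toPoly K) := by
  have hq : ∀ d : Fin n →₀ ℕ, ∃ q : Koszul K n c ⧸ N, ∀ u : Fin n →₀ ℕ, u.degree = c → u ≤ d →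
      N.mkQ (MvPolynomial.monomial (d - u) (1 : K) • basisVec K c u) = q := by
    intro d
    by_cases h : ∃ u₀ : Fin n →₀ ℕ, u₀.degree = c ∧ u₀ ≤ d
    · obtain ⟨u₀, hu₀, hle₀⟩ := h
      refine ⟨N.mkQ (MvPolynomial.monomial (d - u₀) (1 : K) • basisVec K c u₀), fun u hu hle => ?_⟩
      refine eq_of_exchange c d
        (fun u => N.mkQ (MvPolynomial.monomial (d - u) (1 : K) • basisVec K c u)) ?_ u u₀ hu hu₀
        hle hle₀
      intro a i j ha hij
      obtain ⟨m, rfl⟩ := le_iff_exists_add.1 hij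
      have hmem := N.smul_mem (MvPolynomial.monomial m 1) (hz _ ha ⟨a, rfl⟩ j i)
      rw [zElement_eq, smul_sub, smul_smul, smul_smul, ← MvPolynomial.monomial_add_single_one,
        ← MvPolynomial.monomial_add_single_one] at hmem
      have e1 : a + Finsupp.single i 1 + Finsupp.single j 1 + m - (a + Finsupp.single i 1) =
          m + Finsupp.single j 1 := by
        rw [add_assoc, add_tsub_cancel_left, add_comm]
      have e2 : a + Finsupp.single i 1 + Finsupp.single j 1 + m - (a + Finsupp.single j 1) =
          m + Finsupp.single i 1 := by
        rw [add_right_comm a, add_assoc, add_tsub_cancel_left, add_comm]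
      simp only [e1, e2]
      rw [← sub_eq_zero, ← map_sub, Submodule.mkQ_apply, Submodule.Quotient.mk_eq_zero]
      exact hmem
    · exact ⟨0, fun u hu hle => absurd ⟨u, hu, hle⟩ h⟩
  choose q hq using hq
  obtain ⟨P, hP⟩ := MvPolynomial.exists_linearMap_monomial (K := K) q
  refine ⟨P, fun u f => ?_⟩
  induction f using MvPolynomial.induction_on' with
  | monomial m a =>
    have hm : MvPolynomial.monomial m a = a • MvPolynomial.monomial m (1 : K) := by
      rw [MvPolynomial.smul_monomial, smul_eq_mul, mul_one]
    have h := hq (m + u.1) u.1 u.2 le_add_self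
    rw [add_tsub_cancel_right] at h
    rw [hm, smul_mul_assoc, smul_assoc, P.map_smul, Mon.toPoly, MvPolynomial.monomial_mul,
      one_mul, hP, Submodule.mkQ_apply, Submodule.Quotient.mk_smul N a, ← Submodule.mkQ_apply, h]
  | add f g hf hg => rw [add_smul, map_add, hf, hg, add_mul, map_add]

/-- The coefficient of `[u, v]`, up to sign. -/
noncomputable def coord (u v : Mon n c) : Koszul K n c →ₗ[MvPolynomial (Fin n) K]
    MvPolynomial (Fin n) K :=
  (ExteriorAlgebra.algebraMapInv (M := VeroneseFree K n c)).toLinearMap ∘ₗ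
    CliffordAlgebra.contractLeft (Finsupp.lapply u) ∘ₗ
      CliffordAlgebra.contractLeft (Finsupp.lapply v)

theorem coord_ι_mul_ι (u v : Mon n c) (x y : VeroneseFree K n c) :
    coord u v (ExteriorAlgebra.ι (MvPolynomial (Fin n) K) x *
      ExteriorAlgebra.ι (MvPolynomial (Fin n) K) y) = x v * y u - y v * x u := by
  have h1 := CliffordAlgebra.contractLeft_ι_mul (Q := (0 : QuadraticForm (MvPolynomial (Fin n) K)
    (VeroneseFree K n c))) (Finsupp.lapply v) x (CliffordAlgebra.ι _ y)
  rw [CliffordAlgebra.contractLeft_ι] at h1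
  simp only [coord, LinearMap.comp_apply]
  erw [h1]
  rw [map_sub, map_smul, CliffordAlgebra.contractLeft_ι, CliffordAlgebra.contractLeft_mul_algebraMap,
    CliffordAlgebra.contractLeft_ι]
  simp only [AlgHom.toLinearMap_apply, map_sub, map_smul, map_mul]
  erw [AlgHom.commutes, AlgHom.commutes, AlgHom.commutes]
  simp [mul_comm]

theorem coord_swap (u v : Mon n c) (w : Koszul K n c) : coord u v w = -coord v u w := by
  simp only [coord, LinearMap.comp_apply]
  rw [CliffordAlgebra.contractLeft_comm, map_neg]

/-- The sum runs over ordered pairs, so each `[u] ∧ [v]` is counted twice. This avoids ordering the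
monomials, at the price of the factor 2. -/
theorem sum_coord_smul {w : Koszul K n c}
    (hw : w ∈ ⋀[MvPolynomial (Fin n) K]^2 (VeroneseFree K n c)) :
    ∑ u, ∑ v, coord u v w • (basisVec K c v.1 * basisVec K c u.1) = (2 : ℕ) • w := by
  rw [ExteriorAlgebra.exteriorPower, pow_two] at hw
  induction hw using Submodule.mul_induction_on' with
  | mem_mul_mem x hx y hy =>
    obtain ⟨x, rfl⟩ := hx
    obtain ⟨y, rfl⟩ := hy
    simp only [coord_ι_mul_ι, sub_smul, Finset.sum_sub_distrib]
    have hs : ∀ x y : VeroneseFree K n c,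
        ∑ u, ∑ v, (x v * y u) • (basisVec K c v.1 * basisVec K c u.1) =
          ExteriorAlgebra.ι (MvPolynomial (Fin n) K) x *
            ExteriorAlgebra.ι (MvPolynomial (Fin n) K) y := fun x y => by
      rw [ι_eq_sum, ι_eq_sum, Finset.sum_mul_sum, Finset.sum_comm]
      simp only [smul_mul_smul_comm]
    rw [hs, hs, two_smul, sub_eq_add_neg,
      ← eq_neg_of_add_eq_zero_left (ExteriorAlgebra.ι_add_mul_swap x y)]
  | add x _ y _ hx hy => simp only [map_add, add_smul, Finset.sum_add_distrib, hx, hy, smul_add]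

/-- Since `φ` is the sum of the coordinate forms weighted by the monomials `u`, the left side
contracts `w` by the form of `v` and then by `φ`. Contractions anticommute, and contraction by `φ`
is `∂`. -/
theorem sum_coord_mul_toPoly {w : Koszul K n c} (hw : koszulDiff K n c w = 0) (v : Mon n c) :
    ∑ u, coord u v w * u.toPoly K = 0 := by
  have h : veronesePhi K n c = ∑ u : Mon n c, u.toPoly K •
      (Finsupp.lapply u : VeroneseFree K n c →ₗ[MvPolynomial (Fin n) K] _) := by
    ext u : 2
    simp [veronesePhi, Finsupp.single_apply]
  have h2 : ∑ u, coord u v w * u.toPoly K = (ExteriorAlgebra.algebraMapInv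
      (M := VeroneseFree K n c)).toLinearMap (CliffordAlgebra.contractLeft (veronesePhi K n c)
        (CliffordAlgebra.contractLeft (Finsupp.lapply v) w)) := by
    rw [h]
    simp only [map_sum, LinearMap.sum_apply, map_smul, LinearMap.smul_apply, smul_eq_mul, mul_comm,
      coord, LinearMap.comp_apply]
  rw [h2, CliffordAlgebra.contractLeft_comm]
  rw [koszulDiff] at hw
  erw [hw]
  simp

theorem mem_koszulCycles_one {w : Koszul K n c} : w ∈ koszulCycles K n c 1 ↔
    ∃ m, veronesePhi K n c m = 0 ∧ ExteriorAlgebra.ι (MvPolynomial (Fin n) K) m = w := by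
  rw [koszulCycles, ExteriorAlgebra.exteriorPower, pow_one]
  constructor
  · rintro ⟨⟨m, rfl⟩, hm⟩
    refine ⟨m, ?_, rfl⟩
    rw [SetLike.mem_coe, LinearMap.mem_ker, koszulDiff] at hm
    have := hm.symm.trans (CliffordAlgebra.contractLeft_ι _ _ m)
    exact ((ExteriorAlgebra.algebraMap_eq_zero_iff _ _).1 this.symm)
  · rintro ⟨m, hm, rfl⟩
    refine ⟨⟨m, rfl⟩, ?_⟩
    refine (CliffordAlgebra.contractLeft_ι _ _ m).trans ?_
    rw [hm, map_zero]

theorem zElement_mem (r : ℕ) (h : r + 1 = c) (b : Mon n r) (i j : Fin n) :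
    zElement K h b i j ∈ koszulCycles K n c 1 := by
  have hu : ∀ i, (b.1 + Finsupp.single i 1).degree = c := fun i => by
    rw [map_add, Finsupp.degree_single, b.2, h]
  rw [zElement_eq]
  refine ⟨?_, ?_⟩
  · rw [SetLike.mem_coe, ExteriorAlgebra.exteriorPower, pow_one]
    exact sub_mem (Submodule.smul_mem _ _ (basisVec_mem_range _))
      (Submodule.smul_mem _ _ (basisVec_mem_range _))
  · rw [SetLike.mem_coe, LinearMap.mem_ker, map_sub, map_smul, map_smul,
      koszulDiff_basisVec K (hu i), koszulDiff_basisVec K (hu j),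
      MvPolynomial.monomial_add_single_one, MvPolynomial.monomial_add_single_one]
    module

theorem mul_mem_koszulCycles_two {x y : Koszul K n c} (hx : x ∈ koszulCycles K n c 1)
    (hy : y ∈ koszulCycles K n c 1) : x * y ∈ koszulCycles K n c 2 := by
  obtain ⟨x, hφ, rfl⟩ := mem_koszulCycles_one.1 hx
  refine ⟨?_, ?_⟩
  · have h1 := hy.1
    rw [SetLike.mem_coe, ExteriorAlgebra.exteriorPower, pow_one] at h1
    rw [SetLike.mem_coe, ExteriorAlgebra.exteriorPower, pow_two]
    exact Submodule.mul_mem_mul ⟨x, rfl⟩ h1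
  · have h1 := hy.2
    rw [SetLike.mem_coe, LinearMap.mem_ker] at h1 ⊢
    refine (CliffordAlgebra.contractLeft_ι_mul _ _ _).trans ?_
    rw [hφ, zero_smul, zero_sub]
    refine neg_eq_zero.2 (Eq.trans (congrArg _ h1) (mul_zero _))

theorem bcrElement_two_mem {r : ℕ} (h : r + 1 = c) (a : Fin 3 → Mon n 1) (b : Fin 2 → Mon n r) :
    bcrElement K h a b ∈ koszulCycles K n c 2 := by
  have ha : ∀ l, ∃ i, (a l).1 = Finsupp.single i 1 := fun l => by
    obtain ⟨w, i, hw, hw0⟩ := Finsupp.exists_eq_add_single (a l).2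
    rw [Finsupp.degree_eq_zero_iff] at hw0
    exact ⟨i, by rw [hw, hw0, zero_add]⟩
  obtain ⟨i, hi⟩ := ha 0
  obtain ⟨j, hj⟩ := ha 1
  obtain ⟨k, hk⟩ := ha 2
  have hu : ∀ l i, ((b l).1 + Finsupp.single i 1).degree = c := fun l i => by
    rw [map_add, Finsupp.degree_single, (b l).2, h]
  rw [bcrElement_two K h a b i j k hi hj hk]
  have hm : ∀ (f : MvPolynomial (Fin n) K) (u v : Fin n →₀ ℕ),
      f • (basisVec K c u * basisVec K c v) ∈ ⋀[MvPolynomial (Fin n) K]^2 (VeroneseFree K n c) :=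
    fun f u v => by
      rw [ExteriorAlgebra.exteriorPower, pow_two]
      exact Submodule.smul_mem _ _
        (Submodule.mul_mem_mul (basisVec_mem_range _) (basisVec_mem_range _))
  refine ⟨add_mem (add_mem (sub_mem (sub_mem (sub_mem (hm _ _ _) (hm _ _ _)) (hm _ _ _))
    (hm _ _ _)) (hm _ _ _)) (hm _ _ _), ?_⟩
  rw [SetLike.mem_coe, LinearMap.mem_ker]
  simp only [map_add, map_sub, map_smul, koszulDiff_basisVec_mul K (hu _ _),
    koszulDiff_basisVec K (hu _ _), MvPolynomial.monomial_add_single_one, mul_smul_comm, mul_one]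
  module

variable (K n c) in
theorem koszulCycles_one_eq_span : koszulCycles K n c 1 = Submodule.span (MvPolynomial (Fin n) K)
    {w | ∃ (r : ℕ) (hr : r + 1 = c) (b : Mon n r) (i j : Fin n), w = zElement K hr b i j} := by
  apply le_antisymm
  · intro w hw
    obtain ⟨m, hm, rfl⟩ := mem_koszulCycles_one.1 hw
    obtain ⟨P, hP⟩ := exists_smul_basisVec_eq (K := K) (n := n) (c := c) (N := Submodule.span (MvPolynomial (Fin n) K)
      {w | ∃ (r : ℕ) (hr : r + 1 = c) (b : Mon n r) (i j : Fin n), w = zElement K hr b i j})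
      (fun r h b i j => Submodule.subset_span ⟨r, h, b, i, j, rfl⟩)
    rw [← Submodule.Quotient.mk_eq_zero, ← Submodule.mkQ_apply, ι_eq_sum, map_sum]
    simp only [hP]
    rw [← map_sum]
    convert map_zero P
    rw [← hm, veronesePhi, Finsupp.linearCombination_apply, Finsupp.sum_fintype _ _ (by simp)]
    rfl
  · rw [Submodule.span_le]
    rintro _ ⟨r, h, b, i, j, rfl⟩
    exact zElement_mem r h b i j

/-- After the splitting, each sum over `u` or over `v` is a linear map applied to an expression that
vanishes for a cycle; the second family is reduced to the first by antisymmetry of `coord`. -/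
theorem koszulCycles_two_le (hK : ringChar K ≠ 2) (hb : bcrCycles K n c 2 (2 * c + 1) ⊆ N)
    (hz : zProducts K n c ⊆ N) : koszulCycles K n c 2 ≤ N := by
  rintro w ⟨hw, hw'⟩
  rw [SetLike.mem_coe, LinearMap.mem_ker] at hw'
  have h2 : (2 : ℕ) • w ∈ N := by
    obtain ⟨P, Q, hPQ⟩ := exists_smul_basisVec_mul_eq_add hb hz
    rw [← sum_coord_smul hw, ← Submodule.Quotient.mk_eq_zero, ← Submodule.mkQ_apply]
    simp only [map_sum, hPQ, Finset.sum_add_distrib]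
    rw [Finset.sum_comm]
    simp only [← map_sum, sum_coord_mul_toPoly hw', map_zero, Finset.sum_const_zero, zero_add]
    refine Finset.sum_eq_zero fun u _ => ?_
    simp only [coord_swap u, neg_mul, Finset.sum_neg_distrib, sum_coord_mul_toPoly hw', neg_zero,
      map_zero]
  have h3 := N.smul_mem (MvPolynomial.C (2⁻¹ : K)) h2
  have h4 : (2 : K) ≠ 0 := Ring.two_ne_zero hK
  have h5 : (MvPolynomial.C (2⁻¹ : K) : MvPolynomial (Fin n) K) * 2 = 1 := by
    rw [← map_ofNat (MvPolynomial.C (σ := Fin n) (R := K)) 2, ← map_mul, inv_mul_cancel₀ h4, map_one]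
  rwa [← Nat.cast_smul_eq_nsmul (MvPolynomial (Fin n) K), smul_smul, Nat.cast_ofNat, h5,
    one_smul] at h3

end

/-! ### The internal grading and the component of degree `2 c + 2` -/

theorem MvPolynomial.homogeneousComponent_mul_of_isHomogeneous {σ R : Type*} [CommSemiring R]
    {q : MvPolynomial σ R} {d : ℕ} (hq : q.IsHomogeneous d) (p : MvPolynomial σ R) :
    MvPolynomial.homogeneousComponent d (p * q) = MvPolynomial.coeff 0 p • q := by
  classical
  induction p using MvPolynomial.induction_on' with
  | monomial m a =>
    rw [MvPolynomial.homogeneousComponent_of_mem ((MvPolynomial.mem_homogeneousSubmodule _ _).2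
      ((MvPolynomial.isHomogeneous_monomial a rfl).mul hq)), MvPolynomial.coeff_monomial]
    by_cases hm : m = 0
    · subst hm
      simp [MvPolynomial.smul_eq_C_mul, MvPolynomial.monomial_zero']
    · rw [if_neg hm, if_neg, zero_smul]
      rw [← Finsupp.degree_eq_zero_iff] at hm
      omega
  | add p p' hp hp' => rw [add_mul, map_add, hp, hp', MvPolynomial.coeff_add, add_smul]

section

variable {K : Type*} [Field K] {n c : ℕ}

/-- Constancy of these coordinates lets homogeneous components be taken coefficient by coefficient.
-/
theorem exists_coord_eq_C (u v : Mon n c) (a b : Fin n →₀ ℕ) :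
    ∃ k : K, coord u v (basisVec K c a * basisVec K c b) = MvPolynomial.C k := by
  classical
  by_cases ha : a.degree = c
  swap
  · exact ⟨0, by rw [basisVec, dif_neg ha, zero_mul, map_zero, map_zero]⟩
  by_cases hb : b.degree = c
  swap
  · exact ⟨0, by rw [basisVec_mul_comm, basisVec, dif_neg hb, zero_mul, neg_zero, map_zero,
      map_zero]⟩
  rw [basisVec, basisVec, dif_pos ha, dif_pos hb, coord_ι_mul_ι]
  have h : ∀ x y : Mon n c, ∃ k : K,
      (Finsupp.single x (1 : MvPolynomial (Fin n) K)) y = MvPolynomial.C k := fun x y =>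
    ⟨if x = y then 1 else 0, by rw [Finsupp.single_apply]; split_ifs <;> simp⟩
  obtain ⟨k₁, h₁⟩ := h ⟨a, ha⟩ v
  obtain ⟨k₂, h₂⟩ := h ⟨b, hb⟩ u
  obtain ⟨k₃, h₃⟩ := h ⟨b, hb⟩ v
  obtain ⟨k₄, h₄⟩ := h ⟨a, ha⟩ u
  exact ⟨k₁ * k₂ - k₃ * k₄, by rw [h₁, h₂, h₃, h₄, map_sub, map_mul, map_mul]⟩

variable (K n c) in
/-- Twice the projection of `⋀² F` onto its homogeneous component of degree `2 c + d`. -/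
noncomputable def twiceHomogeneousComponent (d : ℕ) : Koszul K n c →ₗ[K] Koszul K n c :=
  ∑ u : Mon n c, ∑ v : Mon n c,
    (LinearMap.toSpanSingleton (MvPolynomial (Fin n) K) (Koszul K n c)
      (basisVec K c v.1 * basisVec K c u.1)).restrictScalars K ∘ₗ
    MvPolynomial.homogeneousComponent d ∘ₗ (coord u v).restrictScalars K

theorem twiceHomogeneousComponent_smul (d : ℕ) (f : MvPolynomial (Fin n) K) (a b : Fin n →₀ ℕ) :
    twiceHomogeneousComponent K n c d (f • (basisVec K c a * basisVec K c b)) =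
      (2 : ℕ) • MvPolynomial.homogeneousComponent d f • (basisVec K c a * basisVec K c b) := by
  have hab : basisVec K c a * basisVec K c b ∈
      ⋀[MvPolynomial (Fin n) K]^2 (VeroneseFree K n c) := by
    rw [ExteriorAlgebra.exteriorPower, pow_two]
    exact Submodule.mul_mem_mul (basisVec_mem_range _) (basisVec_mem_range _)
  rw [smul_comm, ← sum_coord_smul hab, twiceHomogeneousComponent]
  simp only [LinearMap.sum_apply, Finset.smul_sum]
  refine Finset.sum_congr rfl fun u _ => Finset.sum_congr rfl fun v _ => ?_
  obtain ⟨k, hk⟩ := exists_coord_eq_C (K := K) u v a b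
  simp only [LinearMap.comp_apply, LinearMap.restrictScalars_apply, map_smul, hk, smul_eq_mul,
    LinearMap.toSpanSingleton_apply, smul_smul]
  rw [mul_comm f, MvPolynomial.homogeneousComponent_C_mul, mul_comm]

theorem twiceHomogeneousComponent_of_mem {d : ℕ} {w : Koszul K n c}
    (hw : w ∈ koszulHomogeneous K n c 2 (2 * c + d)) :
    twiceHomogeneousComponent K n c d w = (2 : ℕ) • w := by
  induction hw using Submodule.span_induction with
  | mem w hw =>
    obtain ⟨e, v, u, he, rfl⟩ := hw
    obtain rfl : e = d := by omega
    rw [bracket_two, twiceHomogeneousComponent_smul, Mon.toPoly,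
      MvPolynomial.homogeneousComponent_of_mem ((MvPolynomial.mem_homogeneousSubmodule _ _).2
        (MvPolynomial.isHomogeneous_monomial 1 v.2)), if_pos rfl]
  | zero => rw [map_zero, smul_zero]
  | add x y _ _ hx hy => rw [map_add, hx, hy, smul_add]
  | smul a x _ hx => rw [map_smul, hx, smul_comm]

theorem mem_koszulHomogeneous_of_isHomogeneous {d : ℕ} {f : MvPolynomial (Fin n) K}
    (hf : f.IsHomogeneous d) (u : Fin 2 → Mon n c) :
    f • bracket K u ∈ koszulHomogeneous K n c 2 (2 * c + d) := by
  rw [f.as_sum, Finset.sum_smul]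
  refine sum_mem fun m hm => ?_
  have hd : m.degree = d := by
    rw [← hf (MvPolynomial.mem_support_iff.1 hm), Finsupp.degree_eq_weight_one]
    rfl
  have h : MvPolynomial.monomial m (f.coeff m) = f.coeff m • Mon.toPoly K (⟨m, hd⟩ : Mon n d) := by
    rw [Mon.toPoly, MvPolynomial.smul_monomial, smul_eq_mul, mul_one]
  rw [h, smul_assoc]
  exact Submodule.smul_mem _ _ (Submodule.subset_span ⟨d, _, u, add_comm _ _, rfl⟩)

theorem zElement_mul_zElement {r : ℕ} (hr : r + 1 = c) (a b : Mon n r) (i j h k : Fin n) :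
    zElement K hr a i j * zElement K hr b h k =
      (MvPolynomial.X i * MvPolynomial.X h : MvPolynomial (Fin n) K) •
        bracket K ![Mon.mul hr a (Mon.var j), Mon.mul hr b (Mon.var k)]
      - (MvPolynomial.X i * MvPolynomial.X k : MvPolynomial (Fin n) K) •
        bracket K ![Mon.mul hr a (Mon.var j), Mon.mul hr b (Mon.var h)]
      - (MvPolynomial.X j * MvPolynomial.X h : MvPolynomial (Fin n) K) •
        bracket K ![Mon.mul hr a (Mon.var i), Mon.mul hr b (Mon.var k)]
      + (MvPolynomial.X j * MvPolynomial.X k : MvPolynomial (Fin n) K) •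
        bracket K ![Mon.mul hr a (Mon.var i), Mon.mul hr b (Mon.var h)] := by
  simp only [zElement, bracket_one, bracket_two, sub_mul, mul_sub, smul_mul_smul_comm,
    Matrix.cons_val_zero, Matrix.cons_val_one]
  abel

theorem isHomogeneous_X_mul_X (i j : Fin n) :
    (MvPolynomial.X i * MvPolynomial.X j : MvPolynomial (Fin n) K).IsHomogeneous 2 :=
  (MvPolynomial.isHomogeneous_X K i).mul (MvPolynomial.isHomogeneous_X K j)

variable (K n c) in
theorem zProducts_subset_koszulHomogeneous :
    zProducts K n c ⊆ koszulHomogeneous K n c 2 (2 * c + 2) := by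
  rintro _ ⟨r, hr, a, b, i, j, h, k, rfl⟩
  rw [zElement_mul_zElement]
  have hm := fun (i j : Fin n) (u : Fin 2 → Mon n c) =>
    mem_koszulHomogeneous_of_isHomogeneous (isHomogeneous_X_mul_X (K := K) i j) u
  exact add_mem (sub_mem (sub_mem (hm _ _ _) (hm _ _ _)) (hm _ _ _)) (hm _ _ _)

theorem twiceHomogeneousComponent_smul_zProduct (f : MvPolynomial (Fin n) K) {z : Koszul K n c}
    (hz : z ∈ zProducts K n c) :
    twiceHomogeneousComponent K n c 2 (f • z) = (2 : ℕ) • f.coeff 0 • z := by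
  obtain ⟨r, hr, a, b, i, j, h, k, rfl⟩ := hz
  have hm : ∀ (i j : Fin n) (u : Fin 2 → Mon n c), twiceHomogeneousComponent K n c 2
      (f • (MvPolynomial.X i * MvPolynomial.X j : MvPolynomial (Fin n) K) • bracket K u) =
      (2 : ℕ) • f.coeff 0 • (MvPolynomial.X i * MvPolynomial.X j : MvPolynomial (Fin n) K) •
        bracket K u := fun i j u => by
    rw [bracket_two, smul_smul, twiceHomogeneousComponent_smul,
      MvPolynomial.homogeneousComponent_mul_of_isHomogeneous (isHomogeneous_X_mul_X i j),
      smul_assoc]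
  rw [zElement_mul_zElement]
  simp only [smul_add, smul_sub, map_add, map_sub, hm]

theorem bcrCycles_subset_koszulHomogeneous (t d : ℕ) :
    bcrCycles K n c t d ⊆ koszulHomogeneous K n c t d := by
  rintro _ ⟨s, r, h, a, b, rfl, rfl⟩
  refine sum_mem fun σ _ => zsmul_mem ?_ _
  exact Submodule.subset_span ⟨s, a (σ (Fin.last t)), _, add_comm _ _, rfl⟩

variable (K n c) in
theorem koszulCycles_one_sq : koszulCycles K n c 1 ^ 2 =
    Submodule.span (MvPolynomial (Fin n) K) (zProducts K n c) := by
  rw [pow_two, koszulCycles_one_eq_span, Submodule.span_mul_span]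
  congr 1
  ext w
  constructor
  · rintro ⟨_, ⟨r, hr, a, i, j, rfl⟩, _, ⟨r', hr', b, h, k, rfl⟩, rfl⟩
    obtain rfl : r = r' := by omega
    exact ⟨r, hr, a, b, i, j, h, k, rfl⟩
  · rintro ⟨r, hr, a, b, i, j, h, k, rfl⟩
    exact ⟨_, ⟨r, hr, a, i, j, rfl⟩, _, ⟨r, hr, b, h, k, rfl⟩, rfl⟩

theorem twiceHomogeneousComponent_mem_span {w : Koszul K n c}
    (hw : w ∈ Submodule.span (MvPolynomial (Fin n) K) (zProducts K n c)) :
    twiceHomogeneousComponent K n c 2 w ∈ Submodule.span K (zProducts K n c) := by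
  -- The projection is only `K`-linear, so the induction over the `S`-span must carry all multiples
  -- `f • w`.
  suffices h : ∀ f : MvPolynomial (Fin n) K,
      twiceHomogeneousComponent K n c 2 (f • w) ∈ Submodule.span K (zProducts K n c) by
    simpa using h 1
  induction hw using Submodule.span_induction with
  | mem z hz =>
    intro f
    rw [twiceHomogeneousComponent_smul_zProduct f hz]
    exact nsmul_mem (Submodule.smul_mem _ _ (Submodule.subset_span hz)) _
  | zero => simp
  | add x y _ _ hx hy => exact fun f => by rw [smul_add, map_add]; exact add_mem (hx f) (hy f)
  | smul g x _ hx => exact fun f => by rw [smul_smul]; exact hx _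

end

theorem proposition5p4 (K : Type*) [Field K] (hK : ringChar K ≠ 2) (n c : ℕ) (hc : 1 ≤ c) :
    Submodule.span (MvPolynomial (Fin n) K) (bcrCycles K n c 2 (2 * c + 1) ∪ zProducts K n c) =
        koszulCycles K n c 2 ∧
      bcrCycles K n c 2 (2 * c + 1) ⊆ koszulHomogeneous K n c 2 (2 * c + 1) ∧
      zProducts K n c ⊆ koszulHomogeneous K n c 2 (2 * c + 2) ∧
      ((koszulCycles K n c 1) ^ 2).restrictScalars K ⊓ koszulHomogeneous K n c 2 (2 * c + 2) =
        Submodule.span K (zProducts K n c) := by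
  refine ⟨le_antisymm ?_ ?_, bcrCycles_subset_koszulHomogeneous _ _,
    zProducts_subset_koszulHomogeneous K n c, le_antisymm ?_ ?_⟩
  · rw [Submodule.span_le]
    rintro _ (⟨s, r, h, a, b, hs, rfl⟩ | ⟨r, hr, a, b, i, j, h, k, rfl⟩)
    · obtain rfl : s = 1 := by omega
      exact bcrElement_two_mem h a b
    · exact mul_mem_koszulCycles_two (zElement_mem _ _ _ _ _) (zElement_mem _ _ _ _ _)
  · exact koszulCycles_two_le hK (Set.subset_union_left.trans Submodule.subset_span)
      (Set.subset_union_right.trans Submodule.subset_span)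
  · rintro w ⟨hw, hw'⟩
    rw [SetLike.mem_coe, Submodule.restrictScalars_mem, koszulCycles_one_sq] at hw
    have h := twiceHomogeneousComponent_mem_span hw
    rw [twiceHomogeneousComponent_of_mem hw'] at h
    have h2 := Submodule.smul_mem _ (2⁻¹ : K) h
    rwa [← Nat.cast_smul_eq_nsmul K, Nat.cast_ofNat, inv_smul_smul₀ (Ring.two_ne_zero hK)] at h2
  · refine Submodule.span_le.2 fun z hz => ⟨?_, zProducts_subset_koszulHomogeneous K n c hz⟩
    rw [SetLike.mem_coe, Submodule.restrictScalars_mem, koszulCycles_one_sq]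
    exact Submodule.subset_span hz
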